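/- Let $M,N\ge 1$, let $\sigma_Z^2>0$, and let $\Sigma$ be a (strictly) positive definite Hermitian $MN\times MN$ matrix. Consider the MIMO Rayleigh flat-fading channel with coherence time $T=1$, input $x\in\mathbb C^N$ and output $y\in\mathbb C^M$, without channel state information at the transmitter or the receiver, whose transition density with respect to Lebesgue measure on $\mathbb C^M$ is $$p(y|x)=\frac{e^{-\operatorname{tr}\left(K(x)^{-1}yy^H\right)}}{\pi^M\det K(x)},\qquad K(x)=\sigma_Z^2\mathbf 1_M+(\mathbf 1_M\otimes x^H)\,\Sigma\,(\mathbf 1_M\otimes x),$$ where $\sigma_Z^2$ is the noise variance and $\Sigma$ is the covariance matrix of the channel coefficients. For a Borel probability measure $\mu$ on $\mathbb C^N$ put $$f_\mu(y)=\int p(y|x)\,\mu(dx),\qquad I(\mu;W)=\int\!\!\int p(y|x)\log\frac{p(y|x)}{f_\mu(y)}\,dy\,\mu(dx).$$ For $a\ge 0$ let $C(a)$ be the supremum of $I(\mu;W)$ over all Borel probability measures $\mu$ on $\mathbb C^N$ that satisfy the average power constraint $\int \frac1N\sum_{n=1}^N|x_n|^2\,\mu(dx)\le a$. Then every capacity-achieving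 input measure, that is, every $\mu$ that satisfies the power constraint and $I(\mu;W)=C(a)$, has bounded support in $\mathbb C^N$. -/

import Mathlib

open MeasureTheory
open scoped Matrix Kronecker ComplexOrder

noncomputable section

namespace RayleighChannel

variable {M N : ℕ}

/-- The matrix `1_M ⊗ x` of size `MN × M`, for a column vector `x ∈ ℂ^N`
(the column index set `Fin M × Unit` of the Kronecker product is identified with `Fin M`). -/
def idKron (M : ℕ) (x : Fin N → ℂ) : Matrix (Fin M × Fin N) (Fin M) ℂ :=
  ((1 : Matrix (Fin M) (Fin M) ℂ) ⊗ₖ Matrix.replicateCol Unit x).submatrix id (fun m => (m, ()))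

/-- The output covariance `σ² 1_M + (1_M ⊗ xᴴ) Σ (1_M ⊗ x)` given the input `x`;
`s` is the noise variance `σ²` and `S` is the `MN × MN` covariance matrix `Σ` of the fading. -/
def outCov (s : ℝ) (S : Matrix (Fin M × Fin N) (Fin M × Fin N) ℂ) (x : Fin N → ℂ) :
    Matrix (Fin M) (Fin M) ℂ :=
  (s : ℂ) • (1 : Matrix (Fin M) (Fin M) ℂ) + (idKron M x)ᴴ * S * idKron M x

/-- The transition density
`p(y|x) = exp (- tr (K(x)⁻¹ y yᴴ)) / (π^M det K(x))`, where `K(x) = outCov s S x`.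
The trace and the determinant are real numbers when `S` is positive definite and `0 < s`. -/
def density (s : ℝ) (S : Matrix (Fin M × Fin N) (Fin M × Fin N) ℂ)
    (x : Fin N → ℂ) (y : Fin M → ℂ) : ℝ :=
  Real.exp (-(Matrix.trace ((outCov s S x)⁻¹ * Matrix.vecMulVec y (star y))).re) /
    (Real.pi ^ M * (outCov s S x).det.re)

/-- The output density `f_μ(y) = ∫ p(y|x) μ(dx)` for the input measure `μ`. -/
def outDensity (s : ℝ) (S : Matrix (Fin M × Fin N) (Fin M × Fin N) ℂ)
    (μ : Measure (Fin N → ℂ)) (y : Fin M → ℂ) : ℝ :=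
  ∫ x, density s S x y ∂μ

/-- The mutual information `I(μ; W) = ∫ ∫ p(y|x) log (p(y|x) / f_μ(y)) dy dμ(x)`, where `dy` is
Lebesgue measure on `ℂ^M`. -/
def mutualInfo (s : ℝ) (S : Matrix (Fin M × Fin N) (Fin M × Fin N) ℂ)
    (μ : Measure (Fin N → ℂ)) : ℝ :=
  ∫ x, ∫ y : Fin M → ℂ,
    density s S x y * Real.log (density s S x y / outDensity s S μ y) ∂volume ∂μ

/-- The transmit power `(1/N) ∑ |x_n|²` of an input vector. -/
def power (x : Fin N → ℂ) : ℝ := (1 / (N : ℝ)) * ∑ n, ‖x n‖ ^ 2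

/-- The Borel probability measures on `ℂ^N` that satisfy the average power constraint `a`. -/
def feasible (N : ℕ) (a : ℝ) : Set (Measure (Fin N → ℂ)) :=
  {μ | IsProbabilityMeasure μ ∧ Integrable power μ ∧ ∫ x, power x ∂μ ≤ a}

/-- The capacity `C(a)`: the supremum of the mutual information over the feasible input measures. -/
def capacity (s : ℝ) (S : Matrix (Fin M × Fin N) (Fin M × Fin N) ℂ) (a : ℝ) : EReal :=
  ⨆ μ ∈ feasible N a, ((mutualInfo s S μ : ℝ) : EReal)

/-- `μ` is a capacity-achieving input measure for the average power constraint `a`. -/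
def IsCapacityAchieving (s : ℝ) (S : Matrix (Fin M × Fin N) (Fin M × Fin N) ℂ) (a : ℝ)
    (μ : Measure (Fin N → ℂ)) : Prop :=
  μ ∈ feasible N a ∧ ((mutualInfo s S μ : ℝ) : EReal) = capacity s S a

end RayleighChannel

end

/-!
Suppose that a capacity-achieving input `μ` has unbounded support; a perturbation of `μ` then
increases the mutual information without increasing the power. Write `f` for the output density of
`μ` and `g(x) = D(p(·|x) ‖ f)` for the relative entropy of the output given the input `x`, so that
`I(μ) = ∫ g dμ`.

* Since `Σ` is positive definite, `K(x)` lies between multiples of `1 + |x|²`. Inputs of large power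
  thus contribute Gaussians of arbitrarily large variance to `f`, so that `f` has a heavier tail
  than any Gaussian (`exists_mul_exp_le_outDensity`). Two consequences: `p(·|x) / f` is bounded for
  every `x` (`exists_density_le_mul_outDensity`), and `g(x) ≤ C_ε + ε |x|²` for every `ε > 0`
  (`exists_relEnt_le`).
* On the other hand `g` is unbounded, because inputs of large power push the output out of every
  ball (`exists_lt_relEnt`). Hence there is a point `z` with `g(z) > I(μ)`.
* Move a small fraction of the mass of `{|x|² > R}` to the origin, and spend the power saved by
  moving a small fraction of the whole of `μ` to `z` (`perturb`). Per unit of power the first step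
  loses at most `C_ε / R + ε` of `∫ g dμ`, which is as small as desired, and the second one gains a
  fixed amount `(g(z) - I(μ)) / (|z|² + 1)`. So the first variation of `∫ g dμ` is positive
  (`IsCapacityAchieving.exists_measure_eq_zero`).
* The boundedness of the ratios `p(·|x) / f` makes the relative change of the output density
  uniformly small, so that the mutual information differs from the average of `g` by a term of
  second order only (`integral_relEnt_sub_sq_le_mutualInfo`). This contradicts optimality
  (`IsCapacityAchieving.variation_nonpos`).

The argument needs neither a Lagrange multiplier nor the Kuhn-Tucker conditions, and no separate
treatment of an inactive power constraint.
-/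

namespace RayleighChannel

/-! ### Quadratic forms of positive definite matrices -/

section Matrix

variable {ι κ : Type*} [Fintype ι] [Fintype κ]

/-- The squared Euclidean norm of a complex vector. -/
noncomputable def sqNorm (v : ι → ℂ) : ℝ := ∑ i, ‖v i‖ ^ 2

lemma sqNorm_nonneg (v : ι → ℂ) : 0 ≤ sqNorm v := Finset.sum_nonneg fun _ _ => sq_nonneg _

lemma continuous_sqNorm : Continuous (sqNorm : (ι → ℂ) → ℝ) := by
  unfold sqNorm; fun_prop

lemma star_dotProduct_self (v : ι → ℂ) : star v ⬝ᵥ v = (sqNorm v : ℂ) := by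
  simp only [dotProduct, sqNorm, Pi.star_apply, RCLike.star_def, Complex.ofReal_sum]
  exact Finset.sum_congr rfl fun i _ => by rw [Complex.conj_mul']; push_cast; rfl

lemma norm_star_dotProduct_sq_le (v w : ι → ℂ) :
    ‖star v ⬝ᵥ w‖ ^ 2 ≤ sqNorm v * sqNorm w := by
  have h : ‖star v ⬝ᵥ w‖ ≤ ∑ i, ‖v i‖ * ‖w i‖ := by
    refine (norm_sum_le _ _).trans (le_of_eq (Finset.sum_congr rfl fun i _ => ?_))
    simp
  calc ‖star v ⬝ᵥ w‖ ^ 2 ≤ (∑ i, ‖v i‖ * ‖w i‖) ^ 2 := by gcongr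
    _ ≤ _ := Finset.sum_mul_sq_le_sq_mul_sq _ _ _

lemma sqNorm_mulVec_le (A : Matrix κ ι ℂ) (v : ι → ℂ) :
    sqNorm (A *ᵥ v) ≤ (∑ i, sqNorm (A i)) * sqNorm v := by
  rw [Finset.sum_mul]
  refine Finset.sum_le_sum fun i _ => ?_
  have h := norm_star_dotProduct_sq_le (star (A i)) v
  rw [star_star] at h
  simpa [sqNorm, Matrix.mulVec] using h

lemma dotProduct_conjTranspose_mul_self_mulVec (B : Matrix κ ι ℂ) (v : ι → ℂ) :
    star v ⬝ᵥ (Bᴴ * B) *ᵥ v = (sqNorm (B *ᵥ v) : ℂ) := by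
  rw [← star_dotProduct_self, ← Matrix.mulVec_mulVec, Matrix.dotProduct_mulVec,
    Matrix.star_mulVec]

variable [DecidableEq ι]

lemma exists_eq_conjTranspose_mul_self {K : Matrix ι ι ℂ} (hK : K.PosDef) :
    ∃ B : Matrix ι ι ℂ, K = Bᴴ * B ∧ IsUnit B := by
  obtain ⟨B, hB⟩ : ∃ B : Matrix ι ι ℂ, K = Bᴴ * B := by
    open scoped MatrixOrder in
    exact CStarAlgebra.nonneg_iff_eq_star_mul_self.1 hK.posSemidef.nonneg
  refine ⟨B, hB, ?_⟩
  have h := hK.isUnit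
  rw [Matrix.isUnit_iff_isUnit_det] at h ⊢
  rw [hB, Matrix.det_mul] at h
  exact isUnit_of_mul_isUnit_right h

lemma exists_mul_sqNorm_le {K : Matrix ι ι ℂ} (hK : K.PosDef) :
    ∃ c > 0, ∀ v, c * sqNorm v ≤ (star v ⬝ᵥ K *ᵥ v).re := by
  obtain ⟨B, rfl, hB⟩ := exists_eq_conjTranspose_mul_self hK
  have hpos : 0 < ∑ i, sqNorm (B⁻¹ i) + 1 := by
    have := Finset.sum_nonneg fun i (_ : i ∈ Finset.univ) => sqNorm_nonneg (B⁻¹ i)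
    linarith
  refine ⟨(∑ i, sqNorm (B⁻¹ i) + 1)⁻¹, inv_pos.2 hpos, fun v => ?_⟩
  rw [dotProduct_conjTranspose_mul_self_mulVec, Complex.ofReal_re, inv_mul_le_iff₀ hpos]
  have h := sqNorm_mulVec_le B⁻¹ (B *ᵥ v)
  rw [Matrix.mulVec_mulVec, Matrix.nonsing_inv_mul _ ((Matrix.isUnit_iff_isUnit_det _).1 hB),
    Matrix.one_mulVec] at h
  linarith [sqNorm_nonneg (B *ᵥ v)]

lemma exists_le_mul_sqNorm {K : Matrix ι ι ℂ} (hK : K.PosDef) :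
    ∃ C ≥ 0, ∀ v, (star v ⬝ᵥ K *ᵥ v).re ≤ C * sqNorm v := by
  obtain ⟨B, rfl, -⟩ := exists_eq_conjTranspose_mul_self hK
  refine ⟨∑ i, sqNorm (B i), Finset.sum_nonneg fun i _ => sqNorm_nonneg _, fun v => ?_⟩
  rw [dotProduct_conjTranspose_mul_self_mulVec, Complex.ofReal_re]
  exact sqNorm_mulVec_le B v

/-- The quadratic form `yᴴ K⁻¹ y`, as a real number. -/
noncomputable def invForm (K : Matrix ι ι ℂ) (y : ι → ℂ) : ℝ :=
  (Matrix.trace (K⁻¹ * Matrix.vecMulVec y (star y))).re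

lemma invForm_eq (K : Matrix ι ι ℂ) (y : ι → ℂ) :
    invForm K y = (star y ⬝ᵥ K⁻¹ *ᵥ y).re := by
  rw [invForm, Matrix.mul_vecMulVec, Matrix.trace_vecMulVec, dotProduct_comm]

lemma invForm_conjTranspose_mul_self {B : Matrix ι ι ℂ} (hB : IsUnit B) (z : ι → ℂ) :
    invForm (Bᴴ * B) (Bᴴ *ᵥ z) = sqNorm z := by
  have hd : IsUnit B.det := (Matrix.isUnit_iff_isUnit_det _).1 hB
  have hd' : IsUnit Bᴴ.det := by rw [Matrix.det_conjTranspose]; exact hd.star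
  rw [invForm_eq, Matrix.mul_inv_rev, Matrix.mulVec_mulVec, Matrix.mul_assoc,
    Matrix.nonsing_inv_mul _ hd', Matrix.mul_one, Matrix.star_mulVec,
    Matrix.conjTranspose_conjTranspose, Matrix.dotProduct_mulVec, Matrix.vecMul_vecMul,
    Matrix.mul_nonsing_inv _ hd, Matrix.vecMul_one, star_dotProduct_self, Complex.ofReal_re]

/-- For a factorization `K = Bᴴ B` and `w = K⁻¹ y`, one has `y = Bᴴ B w` and `yᴴ K⁻¹ y = |B w|²`. -/
lemma exists_whitening {K : Matrix ι ι ℂ} (hK : K.PosDef) (y : ι → ℂ) :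
    ∃ (B : Matrix ι ι ℂ) (w : ι → ℂ), K = Bᴴ * B ∧ y = Bᴴ *ᵥ (B *ᵥ w) ∧
      invForm K y = sqNorm (B *ᵥ w) := by
  obtain ⟨B, rfl, hB⟩ := exists_eq_conjTranspose_mul_self hK
  have hd := (Matrix.isUnit_iff_isUnit_det _).1 hK.isUnit
  have hy : y = Bᴴ *ᵥ (B *ᵥ ((Bᴴ * B)⁻¹ *ᵥ y)) := by
    rw [Matrix.mulVec_mulVec, Matrix.mulVec_mulVec, Matrix.mul_nonsing_inv _ hd,
      Matrix.one_mulVec]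
  refine ⟨B, (Bᴴ * B)⁻¹ *ᵥ y, rfl, hy, ?_⟩
  conv_lhs => rw [hy]
  exact invForm_conjTranspose_mul_self hB _

lemma invForm_nonneg {K : Matrix ι ι ℂ} (hK : K.PosDef) (y : ι → ℂ) : 0 ≤ invForm K y := by
  obtain ⟨B, w, -, -, h⟩ := exists_whitening hK y
  rw [h]; exact sqNorm_nonneg _

/-- If `c ≤ K` then `K⁻¹ ≤ 1 / c`. With `y = K w`, the form is `yᴴ w = wᴴ K w ≥ c |w|²`, and the
bound follows from the Cauchy-Schwarz inequality for `y` and `w`. -/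
lemma invForm_le {K : Matrix ι ι ℂ} (hK : K.PosDef) {c : ℝ} (hc : 0 < c)
    (h : ∀ v, c * sqNorm v ≤ (star v ⬝ᵥ K *ᵥ v).re) (y : ι → ℂ) :
    invForm K y ≤ sqNorm y / c := by
  obtain ⟨B, w, rfl, hy, hq⟩ := exists_whitening hK y
  have h1 := h w
  rw [dotProduct_conjTranspose_mul_self_mulVec, Complex.ofReal_re, ← hq] at h1
  have h2 : ‖star y ⬝ᵥ w‖ = invForm (Bᴴ * B) y := by
    have : star y ⬝ᵥ w = (sqNorm (B *ᵥ w) : ℂ) := by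
      rw [hy, Matrix.star_mulVec, Matrix.conjTranspose_conjTranspose, ← Matrix.dotProduct_mulVec,
        star_dotProduct_self]
    rw [this, hq, Complex.norm_real, Real.norm_of_nonneg (sqNorm_nonneg _)]
  have h3 := norm_star_dotProduct_sq_le y w
  rw [h2] at h3
  have hq0 := invForm_nonneg hK y
  rw [le_div_iff₀ hc]
  rcases hq0.eq_or_lt with h0 | h0
  · rw [← h0, zero_mul]; exact sqNorm_nonneg _
  · refine le_of_mul_le_mul_right ?_ h0
    have h4 := mul_le_mul_of_nonneg_left h1 (sqNorm_nonneg y)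
    nlinarith

/-- If `K ≤ C` then `1 ≤ C K⁻¹`. With `y = Bᴴ B w`, one has `|y|² = (B y)ᴴ (B w)`, where
`|B y|² ≤ C |y|²` and `|B w|²` is the form. -/
lemma sqNorm_le_mul_invForm {K : Matrix ι ι ℂ} (hK : K.PosDef) {C : ℝ}
    (h : ∀ v, (star v ⬝ᵥ K *ᵥ v).re ≤ C * sqNorm v) (y : ι → ℂ) :
    sqNorm y ≤ C * invForm K y := by
  obtain ⟨B, w, rfl, hy, hq⟩ := exists_whitening hK y
  have h1 := h y
  rw [dotProduct_conjTranspose_mul_self_mulVec, Complex.ofReal_re] at h1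
  have h2 : ‖star (B *ᵥ y) ⬝ᵥ (B *ᵥ w)‖ = sqNorm y := by
    have : star (B *ᵥ y) ⬝ᵥ (B *ᵥ w) = (sqNorm y : ℂ) := by
      rw [Matrix.star_mulVec, ← Matrix.dotProduct_mulVec, ← hy, star_dotProduct_self]
    rw [this, Complex.norm_real, Real.norm_of_nonneg (sqNorm_nonneg _)]
  have h3 := norm_star_dotProduct_sq_le (B *ᵥ y) (B *ᵥ w)
  rw [h2, ← hq] at h3
  have hq0 := invForm_nonneg hK y
  rcases (sqNorm_nonneg y).eq_or_lt with h0 | h0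
  · have hy0 : y = 0 := by
      funext i
      have := (Finset.sum_eq_zero_iff_of_nonneg fun i _ => sq_nonneg ‖y i‖).1 h0.symm i
        (Finset.mem_univ i)
      simpa using this
    have hform : invForm (Bᴴ * B) y = 0 := by rw [invForm_eq, hy0]; simp
    rw [← h0, hform, mul_zero]
  · refine le_of_mul_le_mul_right ?_ h0
    have h4 := mul_le_mul_of_nonneg_right h1 hq0
    nlinarith

lemma pow_card_le_det {K : Matrix ι ι ℂ} (hK : K.PosDef) {c : ℝ} (hc : 0 < c)
    (h : ∀ v, c * sqNorm v ≤ (star v ⬝ᵥ K *ᵥ v).re) :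
    c ^ Fintype.card ι ≤ K.det.re := by
  have hdet : K.det.re = ∏ i, hK.1.eigenvalues i := by
    rw [hK.1.det_eq_prod_eigenvalues]
    change (∏ i, ((hK.1.eigenvalues i : ℝ) : ℂ)).re = _
    rw [← Complex.ofReal_prod, Complex.ofReal_re]
  rw [hdet, ← Finset.card_univ, ← Finset.prod_const]
  refine Finset.prod_le_prod (fun _ _ => hc.le) fun i _ => ?_
  have h1 := h (hK.1.eigenvectorBasis i).ofLp
  have h2 : sqNorm (hK.1.eigenvectorBasis i).ofLp = 1 := by
    have := hK.1.eigenvectorBasis.orthonormal.1 i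
    rw [EuclideanSpace.norm_eq, Real.sqrt_eq_one] at this
    exact this
  rw [h2, mul_one] at h1
  exact h1.trans_eq (hK.1.eigenvalues_eq i).symm

end Matrix

/-! ### Complex Gaussian integrals -/

section Gaussian

variable {ι : Type*} [Fintype ι]

lemma integral_exp_neg_mul_sqNorm {b : ℝ} (hb : 0 < b) :
    ∫ z : ι → ℂ, Real.exp (-b * sqNorm z) = (Real.pi / b) ^ Fintype.card ι := by
  have h1 : ∀ z : ι → ℂ, Real.exp (-b * sqNorm z) = ∏ i, Real.exp (-b * ‖z i‖ ^ 2) := by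
    intro z
    rw [sqNorm, Finset.mul_sum, Real.exp_sum]
  simp_rw [h1]
  rw [integral_fintype_prod_volume_eq_pow (fun w : ℂ => Real.exp (-b * ‖w‖ ^ 2)),
    GaussianFourier.integral_rexp_neg_mul_sq_norm hb]
  simp

variable [DecidableEq ι]

/-- Linear change of variables in `ℂⁿ`: the Jacobian of a complex matrix, as a real linear map, is
the squared modulus of its complex determinant. -/
lemma integral_comp_mulVec {A : Matrix ι ι ℂ} (hA : IsUnit A) (F : (ι → ℂ) → ℝ) :
    ∫ y, F y = ‖A.det‖ ^ 2 * ∫ z, F (A *ᵥ z) := by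
  have hd : A.det ≠ 0 := ((Matrix.isUnit_iff_isUnit_det _).1 hA).ne_zero
  let f : (ι → ℂ) →ₗ[ℝ] (ι → ℂ) := (Matrix.toLin' A).restrictScalars ℝ
  have hdet : LinearMap.det f = ‖A.det‖ ^ 2 := by
    rw [show f = (Matrix.toLin' A).restrictScalars ℝ from rfl, LinearMap.det_restrictScalars,
      LinearMap.det_toLin', Algebra.norm_complex_apply, Complex.normSq_eq_norm_sq]
  have hpos : 0 < ‖A.det‖ ^ 2 := by positivity
  have hf0 : LinearMap.det f ≠ 0 := by rw [hdet]; exact hpos.ne'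
  have hmap := Measure.map_linearMap_addHaar_eq_smul_addHaar (volume : Measure (ι → ℂ)) hf0
  let e := (LinearEquiv.ofIsUnitDet (f := f) (v := Module.finBasis ℝ _)
    (v' := Module.finBasis ℝ _) (by
      rw [LinearMap.det_toMatrix]; exact isUnit_iff_ne_zero.2 hf0)).toContinuousLinearEquiv
  have hemb : MeasurableEmbedding f := e.toHomeomorph.measurableEmbedding
  have h := hemb.integral_map (μ := volume) F
  rw [hmap, integral_smul_measure, hdet, abs_of_pos (inv_pos.2 hpos),
    ENNReal.toReal_ofReal (inv_pos.2 hpos).le, smul_eq_mul] at h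
  have h2 : ∫ z, F (A *ᵥ z) = ∫ z, F (f z) := rfl
  rw [h2, ← h]
  field_simp

/-- The substitution `y = Bᴴ z`, where `K = Bᴴ B`, has real Jacobian `|det Bᴴ|² = det K`. -/
lemma integral_exp_neg_mul_invForm {K : Matrix ι ι ℂ} (hK : K.PosDef) {b : ℝ} (hb : 0 < b) :
    ∫ y, Real.exp (-b * invForm K y) = K.det.re * (Real.pi / b) ^ Fintype.card ι := by
  obtain ⟨B, rfl, hB⟩ := exists_eq_conjTranspose_mul_self hK
  have hB' : IsUnit Bᴴ := (Matrix.isUnit_conjTranspose B).2 hB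
  rw [integral_comp_mulVec hB']
  simp_rw [invForm_conjTranspose_mul_self hB]
  rw [integral_exp_neg_mul_sqNorm hb]
  congr 1
  rw [Matrix.det_mul, Matrix.det_conjTranspose, norm_star, RCLike.star_def, Complex.conj_mul',
    ← Complex.ofReal_pow, Complex.ofReal_re]

lemma integrable_exp_neg_mul_invForm {K : Matrix ι ι ℂ} (hK : K.PosDef) {b : ℝ} (hb : 0 < b) :
    Integrable fun y => Real.exp (-b * invForm K y) := by
  by_contra h
  have h1 := integral_exp_neg_mul_invForm hK hb
  rw [integral_undef h] at h1
  have h2 : 0 < K.det.re := (Complex.pos_iff.1 hK.det_pos).1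
  have : 0 < K.det.re * (Real.pi / b) ^ Fintype.card ι := by positivity
  linarith

end Gaussian

/-! ### The transition density -/

section Channel

variable {M N : ℕ} {s : ℝ} {S : Matrix (Fin M × Fin N) (Fin M × Fin N) ℂ}

lemma idKron_mulVec (x : Fin N → ℂ) (v : Fin M → ℂ) (p : Fin M × Fin N) :
    (idKron M x *ᵥ v) p = v p.1 * x p.2 := by
  simp [idKron, Matrix.mulVec, dotProduct, Matrix.one_apply, mul_comm]

lemma sqNorm_idKron_mulVec (x : Fin N → ℂ) (v : Fin M → ℂ) :
    sqNorm (idKron M x *ᵥ v) = sqNorm x * sqNorm v := by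
  simp only [sqNorm, idKron_mulVec, norm_mul, mul_pow, Fintype.sum_prod_type]
  simp_rw [← Finset.mul_sum, ← Finset.sum_mul, mul_comm]

lemma re_star_dotProduct_outCov_mulVec (x : Fin N → ℂ) (v : Fin M → ℂ) :
    (star v ⬝ᵥ outCov s S x *ᵥ v).re =
      s * sqNorm v + (star (idKron M x *ᵥ v) ⬝ᵥ S *ᵥ (idKron M x *ᵥ v)).re := by
  rw [outCov, Matrix.add_mulVec, dotProduct_add, Matrix.smul_mulVec, Matrix.one_mulVec,
    dotProduct_smul, star_dotProduct_self, Complex.add_re, Matrix.star_mulVec,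
    ← Matrix.dotProduct_mulVec, Matrix.mulVec_mulVec, Matrix.mulVec_mulVec]
  simp

lemma posDef_outCov (hs : 0 < s) (hS : S.PosDef) (x : Fin N → ℂ) : (outCov s S x).PosDef := by
  refine Matrix.PosDef.add_posSemidef ?_ (hS.posSemidef.conjTranspose_mul_mul_same _)
  exact Matrix.PosDef.one.smul (by exact_mod_cast hs)

/-- The output covariance lies between `(s + c |x|²) 1` and `(s + C |x|²) 1`. -/
lemma exists_outCov_bounds (hS : S.PosDef) :
    ∃ c > 0, ∃ C ≥ 0, ∀ (x : Fin N → ℂ) (v : Fin M → ℂ),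
      (s + c * sqNorm x) * sqNorm v ≤ (star v ⬝ᵥ outCov s S x *ᵥ v).re ∧
      (star v ⬝ᵥ outCov s S x *ᵥ v).re ≤ (s + C * sqNorm x) * sqNorm v := by
  obtain ⟨c, hc, hc'⟩ := exists_mul_sqNorm_le hS
  obtain ⟨C, hC, hC'⟩ := exists_le_mul_sqNorm hS
  refine ⟨c, hc, C, hC, fun x v => ?_⟩
  have h1 := hc' (idKron M x *ᵥ v)
  have h2 := hC' (idKron M x *ᵥ v)
  rw [re_star_dotProduct_outCov_mulVec]
  rw [sqNorm_idKron_mulVec] at h1 h2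
  constructor <;> linarith

/-- The normalizing constant `π^M det K(x)` of the transition density; the real part is taken
because the determinant, although real, is a complex number. -/
noncomputable def normConst (s : ℝ) (S : Matrix (Fin M × Fin N) (Fin M × Fin N) ℂ)
    (x : Fin N → ℂ) : ℝ :=
  Real.pi ^ M * (outCov s S x).det.re

lemma density_eq (x : Fin N → ℂ) (y : Fin M → ℂ) :
    density s S x y = Real.exp (-invForm (outCov s S x) y) / normConst s S x := rfl

lemma normConst_pos (hs : 0 < s) (hS : S.PosDef) (x : Fin N → ℂ) : 0 < normConst s S x :=
  mul_pos (by positivity) (Complex.pos_iff.1 (posDef_outCov hs hS x).det_pos).1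

lemma density_pos (hs : 0 < s) (hS : S.PosDef) (x : Fin N → ℂ) (y : Fin M → ℂ) :
    0 < density s S x y :=
  div_pos (Real.exp_pos _) (normConst_pos hs hS x)

lemma density_le_inv_normConst (hs : 0 < s) (hS : S.PosDef) (x : Fin N → ℂ) (y : Fin M → ℂ) :
    density s S x y ≤ (normConst s S x)⁻¹ := by
  rw [density_eq, div_eq_mul_inv]
  refine mul_le_of_le_one_left (inv_nonneg.2 (normConst_pos hs hS x).le) ?_
  exact Real.exp_le_one_iff.2 (neg_nonpos.2 (invForm_nonneg (posDef_outCov hs hS x) y))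

lemma le_normConst (hs : 0 < s) (hS : S.PosDef) {c : ℝ} (hc : 0 ≤ c)
    (h : ∀ (x : Fin N → ℂ) (v : Fin M → ℂ),
      (s + c * sqNorm x) * sqNorm v ≤ (star v ⬝ᵥ outCov s S x *ᵥ v).re) (x : Fin N → ℂ) :
    Real.pi ^ M * (s + c * sqNorm x) ^ M ≤ normConst s S x := by
  have hpos : 0 < s + c * sqNorm x := by have := sqNorm_nonneg x; positivity
  have := pow_card_le_det (posDef_outCov hs hS x) hpos (h x)
  rw [Fintype.card_fin] at this
  exact mul_le_mul_of_nonneg_left this (by positivity)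

lemma exists_density_le (hs : 0 < s) (hS : S.PosDef) :
    ∃ B > 0, ∀ (x : Fin N → ℂ) (y : Fin M → ℂ), density s S x y ≤ B := by
  obtain ⟨c, hc, _, _, h⟩ := exists_outCov_bounds (s := s) hS
  refine ⟨(Real.pi ^ M * s ^ M)⁻¹, by positivity, fun x y => ?_⟩
  refine (density_le_inv_normConst hs hS x y).trans (inv_anti₀ (by positivity) ?_)
  refine le_trans ?_ (le_normConst hs hS hc.le (fun x v => (h x v).1) x)
  have : s ≤ s + c * sqNorm x := by have := sqNorm_nonneg x; nlinarith
  gcongr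

lemma integrable_density (hs : 0 < s) (hS : S.PosDef) (x : Fin N → ℂ) :
    Integrable (density s S x) := by
  have h := integrable_exp_neg_mul_invForm (posDef_outCov hs hS x) one_pos
  simp only [neg_one_mul] at h
  exact h.div_const (normConst s S x)

lemma integral_density (hs : 0 < s) (hS : S.PosDef) (x : Fin N → ℂ) :
    ∫ y, density s S x y = 1 := by
  have h := integral_exp_neg_mul_invForm (posDef_outCov hs hS x) one_pos
  simp only [neg_one_mul, div_one, Fintype.card_fin] at h
  simp only [density_eq]
  rw [integral_div, h, mul_comm]
  exact div_self (normConst_pos hs hS x).ne'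

lemma continuous_outCov : Continuous (outCov s S) := by
  have h : Continuous fun x : Fin N → ℂ => idKron M x := by
    refine continuous_matrix fun i j => ?_
    simp only [idKron, Matrix.submatrix_apply, Matrix.kroneckerMap_apply, Matrix.replicateCol_apply]
    fun_prop
  unfold outCov
  exact continuous_const.add ((h.matrix_conjTranspose.matrix_mul continuous_const).matrix_mul h)

lemma continuous_normConst : Continuous (normConst s S) :=
  continuous_const.mul (Complex.continuous_re.comp continuous_outCov.matrix_det)

lemma continuous_invForm_outCov (hs : 0 < s) (hS : S.PosDef) :
    Continuous fun p : (Fin N → ℂ) × (Fin M → ℂ) => invForm (outCov s S p.1) p.2 := by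
  have hK : Continuous fun p : (Fin N → ℂ) × (Fin M → ℂ) => outCov s S p.1 :=
    continuous_outCov.comp continuous_fst
  have hinv : Continuous fun p : (Fin N → ℂ) × (Fin M → ℂ) => (outCov s S p.1)⁻¹ := by
    simp_rw [Matrix.inv_def, Ring.inverse_eq_inv']
    refine Continuous.smul (hK.matrix_det.inv₀ fun p => ?_) hK.matrix_adjugate
    exact (posDef_outCov hs hS p.1).det_pos.ne'
  unfold invForm
  refine Complex.continuous_re.comp (Continuous.matrix_trace (hinv.matrix_mul ?_))
  exact continuous_snd.matrix_vecMulVec (continuous_star.comp continuous_snd)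

lemma continuous_density (hs : 0 < s) (hS : S.PosDef) :
    Continuous fun p : (Fin N → ℂ) × (Fin M → ℂ) => density s S p.1 p.2 := by
  simp only [density_eq]
  exact (Real.continuous_exp.comp (continuous_invForm_outCov hs hS).neg).div
    (continuous_normConst.comp continuous_fst) fun p => (normConst_pos hs hS p.1).ne'

lemma continuous_density_right (hs : 0 < s) (hS : S.PosDef) (x : Fin N → ℂ) :
    Continuous (density s S x) := by
  have h : Continuous fun y : Fin M → ℂ => (x, y) := by fun_prop
  have h2 := (continuous_density hs hS).comp h
  simpa only [Function.comp_def] using h2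

lemma continuous_invForm (K : Matrix (Fin M) (Fin M) ℂ) : Continuous (invForm K) := by
  unfold invForm
  refine Complex.continuous_re.comp (Continuous.matrix_trace (continuous_const.matrix_mul ?_))
  exact continuous_id.matrix_vecMulVec continuous_star

lemma density_mul_invForm_le (hs : 0 < s) (hS : S.PosDef) (x : Fin N → ℂ) (y : Fin M → ℂ) :
    density s S x y * invForm (outCov s S x) y ≤
      2 * (Real.exp (-(1 / 2) * invForm (outCov s S x) y) / normConst s S x) := by
  have hn := normConst_pos hs hS x
  set q := invForm (outCov s S x) y
  have h1 : q ≤ 2 * Real.exp (q / 2) := by linarith [Real.add_one_le_exp (q / 2)]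
  have h2 : Real.exp (-q) * Real.exp (q / 2) = Real.exp (-(1 / 2) * q) := by
    rw [← Real.exp_add]; congr 1; ring
  have h3 := mul_le_mul_of_nonneg_left h1 (Real.exp_pos (-q)).le
  rw [density_eq, div_mul_eq_mul_div, ← mul_div_assoc, div_le_div_iff_of_pos_right hn]
  linarith

lemma integrable_density_mul_invForm (hs : 0 < s) (hS : S.PosDef) (x : Fin N → ℂ) :
    Integrable fun y => density s S x y * invForm (outCov s S x) y := by
  have hK := posDef_outCov hs hS x
  have h := ((integrable_exp_neg_mul_invForm hK (b := 1 / 2) (by norm_num)).div_const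
    (normConst s S x)).const_mul 2
  have hc : Continuous fun y => density s S x y * invForm (outCov s S x) y :=
    (continuous_density_right hs hS x).mul (continuous_invForm _)
  refine h.mono' hc.aestronglyMeasurable (Filter.Eventually.of_forall fun y => ?_)
  rw [Real.norm_of_nonneg (mul_nonneg (density_pos hs hS x y).le (invForm_nonneg hK y))]
  exact density_mul_invForm_le hs hS x y

lemma integral_density_mul_invForm_le (hs : 0 < s) (hS : S.PosDef) (x : Fin N → ℂ) :
    ∫ y, density s S x y * invForm (outCov s S x) y ≤ 2 * 2 ^ M := by
  have hK := posDef_outCov hs hS x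
  have h := ((integrable_exp_neg_mul_invForm hK (b := 1 / 2) (by norm_num)).div_const
    (normConst s S x)).const_mul 2
  refine (integral_mono (integrable_density_mul_invForm hs hS x) h
    (density_mul_invForm_le hs hS x)).trans_eq ?_
  rw [integral_const_mul, integral_div, integral_exp_neg_mul_invForm hK (by norm_num)]
  have := normConst_pos hs hS x
  have h2 : (outCov s S x).det.re * (Real.pi / (1 / 2)) ^ Fintype.card (Fin M) =
      2 ^ M * normConst s S x := by
    rw [Fintype.card_fin, normConst, div_div_eq_mul_div, div_one, mul_pow]; ring
  rw [h2, mul_div_cancel_right₀ _ this.ne']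

lemma integrable_density_mul_sqNorm (hs : 0 < s) (hS : S.PosDef) (x : Fin N → ℂ) :
    Integrable fun y => density s S x y * sqNorm y := by
  obtain ⟨_, _, C, hC, h⟩ := exists_outCov_bounds (s := s) hS
  have hc : Continuous fun y => density s S x y * sqNorm y :=
    (continuous_density_right hs hS x).mul continuous_sqNorm
  refine ((integrable_density_mul_invForm hs hS x).const_mul (s + C * sqNorm x)).mono'
    hc.aestronglyMeasurable (Filter.Eventually.of_forall fun y => ?_)
  rw [Real.norm_of_nonneg (mul_nonneg (density_pos hs hS x y).le (sqNorm_nonneg y))]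
  have := mul_le_mul_of_nonneg_left (sqNorm_le_mul_invForm (posDef_outCov hs hS x)
    (fun v => (h x v).2) y) (density_pos hs hS x y).le
  linarith

/-- The received power grows at most linearly with the transmitted power. -/
lemma exists_integral_density_mul_sqNorm_le (hs : 0 < s) (hS : S.PosDef) :
    ∃ C > 0, ∀ x : Fin N → ℂ, ∫ y, density s S x y * sqNorm y ≤ C * (1 + sqNorm x) := by
  obtain ⟨_, _, C, hC, h⟩ := exists_outCov_bounds (s := s) hS
  refine ⟨(s + C) * (2 * 2 ^ M), by positivity, fun x => ?_⟩
  have hx := sqNorm_nonneg x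
  calc ∫ y, density s S x y * sqNorm y
      ≤ ∫ y, (s + C * sqNorm x) * (density s S x y * invForm (outCov s S x) y) := by
        refine integral_mono (integrable_density_mul_sqNorm hs hS x)
          ((integrable_density_mul_invForm hs hS x).const_mul _) fun y => ?_
        have := mul_le_mul_of_nonneg_left (sqNorm_le_mul_invForm (posDef_outCov hs hS x)
          (fun v => (h x v).2) y) (density_pos hs hS x y).le
        simp only
        linarith
    _ = (s + C * sqNorm x) * ∫ y, density s S x y * invForm (outCov s S x) y :=
        integral_const_mul _ _
    _ ≤ (s + C * sqNorm x) * (2 * 2 ^ M) := by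
        gcongr
        exact integral_density_mul_invForm_le hs hS x
    _ ≤ ((s + C) * (1 + sqNorm x)) * (2 * 2 ^ M) := by
        gcongr
        nlinarith
    _ = _ := by ring

/-- Upper Gaussian bound on the density of a fixed input. -/
lemma exists_density_le_exp (hs : 0 < s) (hS : S.PosDef) (x : Fin N → ℂ) :
    ∃ δ > 0, ∃ B > 0, ∀ y : Fin M → ℂ, density s S x y ≤ B * Real.exp (-δ * sqNorm y) := by
  obtain ⟨_, _, C, hC, h⟩ := exists_outCov_bounds (s := s) hS
  have hpos : 0 < s + C * sqNorm x := by have := sqNorm_nonneg x; positivity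
  refine ⟨(s + C * sqNorm x)⁻¹, inv_pos.2 hpos, (normConst s S x)⁻¹,
    inv_pos.2 (normConst_pos hs hS x), fun y => ?_⟩
  rw [density_eq, div_eq_inv_mul]
  have h1 := sqNorm_le_mul_invForm (posDef_outCov hs hS x) (fun v => (h x v).2) y
  have := normConst_pos hs hS x
  gcongr
  rw [neg_mul, neg_le_neg_iff, inv_mul_le_iff₀ hpos]
  exact h1

/-- Inputs of large power have slowly decaying densities: for each rate `δ`, once `|x|²` is large
enough, the exponential factor of `p(· | x)` decays no faster than `exp (-δ |y|²)`. -/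
lemma exists_le_density (hs : 0 < s) (hS : S.PosDef) {δ : ℝ} (hδ : 0 < δ) :
    ∃ R : ℝ, ∀ (x : Fin N → ℂ) (y : Fin M → ℂ), R < sqNorm x →
      Real.exp (-δ * sqNorm y) * (normConst s S x)⁻¹ ≤ density s S x y := by
  obtain ⟨c, hc, _, _, h⟩ := exists_outCov_bounds (s := s) hS
  refine ⟨δ⁻¹ / c, fun x y hx => ?_⟩
  have hx0 := sqNorm_nonneg x
  have hpos : 0 < s + c * sqNorm x := by positivity
  have hlarge : δ⁻¹ ≤ s + c * sqNorm x := by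
    rw [div_lt_iff₀ hc] at hx; linarith
  rw [density_eq, div_eq_mul_inv]
  have := normConst_pos hs hS x
  gcongr
  have h1 := invForm_le (posDef_outCov hs hS x) hpos (fun v => (h x v).1) y
  have h2 : sqNorm y / (s + c * sqNorm x) ≤ δ * sqNorm y := by
    rw [div_eq_inv_mul]
    have := inv_le_of_inv_le₀ hδ hlarge
    exact mul_le_mul_of_nonneg_right this (sqNorm_nonneg y)
  linarith

/-- The normalizing constant, hence the spread of the output, is unbounded in the input. -/
lemma exists_lt_normConst (hM : 0 < M) (hN : 0 < N) (hs : 0 < s) (hS : S.PosDef) (A : ℝ) :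
    ∃ x : Fin N → ℂ, A < normConst s S x := by
  obtain ⟨c, hc, _, _, h⟩ := exists_outCov_bounds (s := s) hS
  have hlim : Filter.Tendsto (fun t : ℝ => (Real.pi * (s + c * t)) ^ M) Filter.atTop
      Filter.atTop := by
    refine (Filter.tendsto_pow_atTop hM.ne').comp ?_
    refine Filter.Tendsto.const_mul_atTop Real.pi_pos ?_
    exact Filter.tendsto_atTop_add_const_left _ _ (Filter.tendsto_id.const_mul_atTop hc)
  obtain ⟨t, ht, ht0⟩ := ((hlim.eventually_gt_atTop A).and (Filter.eventually_ge_atTop 0)).exists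
  refine ⟨Pi.single ⟨0, hN⟩ (Real.sqrt t : ℂ), ht.trans_le ?_⟩
  have hx : sqNorm (Pi.single (⟨0, hN⟩ : Fin N) (Real.sqrt t : ℂ)) = t := by
    rw [sqNorm, Finset.sum_eq_single ⟨0, hN⟩]
    · simp [Real.sq_sqrt ht0]
    · intro i _ hi; simp [Pi.single_eq_of_ne hi]
    · simp
  have := le_normConst hs hS hc.le (fun x v => (h x v).1) (Pi.single ⟨0, hN⟩ (Real.sqrt t : ℂ))
  rwa [hx, ← mul_pow] at this

end Channel

/-! ### The output density -/

section Output

variable {M N : ℕ} {s : ℝ} {S : Matrix (Fin M × Fin N) (Fin M × Fin N) ℂ}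
  {μ : Measure (Fin N → ℂ)}

lemma continuous_density_left (hs : 0 < s) (hS : S.PosDef) (y : Fin M → ℂ) :
    Continuous fun x => density s S x y := by
  have h : Continuous fun x : Fin N → ℂ => (x, y) := by fun_prop
  have h2 := (continuous_density hs hS).comp h
  simpa only [Function.comp_def] using h2

lemma integrable_density_left [IsFiniteMeasure μ] (hs : 0 < s) (hS : S.PosDef) (y : Fin M → ℂ) :
    Integrable (fun x => density s S x y) μ := by
  obtain ⟨B, -, hB⟩ := exists_density_le hs hS
  refine (integrable_const B).mono' (continuous_density_left hs hS y).aestronglyMeasurable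
    (Filter.Eventually.of_forall fun x => ?_)
  rw [Real.norm_of_nonneg (density_pos hs hS x y).le]
  exact hB x y

lemma outDensity_pos [IsProbabilityMeasure μ] (hs : 0 < s) (hS : S.PosDef) (y : Fin M → ℂ) :
    0 < outDensity s S μ y := by
  refine (integral_pos_iff_support_of_nonneg (fun x => (density_pos hs hS x y).le)
    (integrable_density_left hs hS y)).2 ?_
  have : Function.support (fun x => density s S x y) = Set.univ :=
    Set.eq_univ_of_forall fun x => (density_pos hs hS x y).ne'
  rw [this, measure_univ]
  exact one_pos

lemma exists_outDensity_le [IsProbabilityMeasure μ] (hs : 0 < s) (hS : S.PosDef) :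
    ∃ B > 0, ∀ y : Fin M → ℂ, outDensity s S μ y ≤ B := by
  obtain ⟨B, hB0, hB⟩ := exists_density_le hs hS
  refine ⟨B, hB0, fun y => ?_⟩
  refine (integral_mono (integrable_density_left hs hS y) (integrable_const B)
    fun x => hB x y).trans_eq ?_
  simp

lemma stronglyMeasurable_outDensity [SFinite μ] (hs : 0 < s) (hS : S.PosDef) :
    StronglyMeasurable (outDensity s S μ : (Fin M → ℂ) → ℝ) := by
  have h : StronglyMeasurable (Function.uncurry fun (y : Fin M → ℂ) (x : Fin N → ℂ) =>
      density s S x y) :=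
    ((continuous_density hs hS).comp continuous_swap).stronglyMeasurable
  exact h.integral_prod_right

lemma integrable_prod_density [IsProbabilityMeasure μ] (hs : 0 < s) (hS : S.PosDef) :
    Integrable (fun p : (Fin N → ℂ) × (Fin M → ℂ) => density s S p.1 p.2) (μ.prod volume) := by
  refine (integrable_prod_iff (continuous_density hs hS).aestronglyMeasurable).2
    ⟨Filter.Eventually.of_forall fun x => integrable_density hs hS x, ?_⟩
  have : (fun x : Fin N → ℂ => ∫ y : Fin M → ℂ, ‖density s S x y‖) = fun _ => (1 : ℝ) := by
    funext x
    simp_rw [Real.norm_of_nonneg (density_pos hs hS x _).le]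
    exact integral_density hs hS x
  simp only [this]
  exact integrable_const _

lemma integrable_outDensity [IsProbabilityMeasure μ] (hs : 0 < s) (hS : S.PosDef) :
    Integrable (outDensity s S μ : (Fin M → ℂ) → ℝ) :=
  (integrable_prod_density hs hS).integral_prod_right

/-- Averaging a bounded function over the output, given the input and then over the input, is
averaging it against the output density. -/
lemma integral_integral_density_mul [IsProbabilityMeasure μ] (hs : 0 < s) (hS : S.PosDef)
    {b : (Fin M → ℂ) → ℝ} (hb : Measurable b) {C : ℝ} (hC : ∀ y, |b y| ≤ C) :
    Integrable (fun x => ∫ y, density s S x y * b y) μ ∧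
    ∫ x, (∫ y, density s S x y * b y) ∂μ = ∫ y, outDensity s S μ y * b y := by
  have h : Integrable (fun p : (Fin N → ℂ) × (Fin M → ℂ) => density s S p.1 p.2 * b p.2)
      (μ.prod volume) :=
    (integrable_prod_density hs hS).mul_bdd (c := C)
      (hb.comp measurable_snd).aestronglyMeasurable (Filter.Eventually.of_forall fun p => hC p.2)
  refine ⟨h.integral_prod_left, ?_⟩
  rw [integral_integral_swap h]
  simp_rw [outDensity, integral_mul_const]

lemma integral_outDensity [IsProbabilityMeasure μ] (hs : 0 < s) (hS : S.PosDef) :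
    ∫ y : Fin M → ℂ, outDensity s S μ y = 1 := by
  have h := (integral_integral_density_mul (μ := μ) hs hS (b := fun _ => 1) measurable_const
    (C := 1) (by simp)).2
  simp only [mul_one, integral_density hs hS] at h
  rw [← h]; simp

/-- An input of unbounded support produces an output density with a tail heavier than that of any
Gaussian. -/
lemma exists_mul_exp_le_outDensity [IsProbabilityMeasure μ] (hs : 0 < s) (hS : S.PosDef)
    (hμ : ∀ R : ℝ, 0 < μ {x | R < sqNorm x}) {δ : ℝ} (hδ : 0 < δ) :
    ∃ c > 0, ∀ y : Fin M → ℂ, c * Real.exp (-δ * sqNorm y) ≤ outDensity s S μ y := by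
  obtain ⟨R, hR⟩ := exists_le_density (N := N) hs hS hδ
  set A : Set (Fin N → ℂ) := {x | R < sqNorm x} with hA
  have hAm : MeasurableSet A := (isOpen_lt continuous_const continuous_sqNorm).measurableSet
  have hinv : Integrable (fun x => (normConst s S x)⁻¹) μ := by
    have h := integrable_density_left (μ := μ) hs hS (0 : Fin M → ℂ)
    refine h.congr (Filter.Eventually.of_forall fun x => ?_)
    simp [density_eq, invForm_eq]
  refine ⟨∫ x in A, (normConst s S x)⁻¹ ∂μ, ?_, fun y => ?_⟩
  · rw [gt_iff_lt, setIntegral_pos_iff_support_of_nonneg_ae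
      (Filter.Eventually.of_forall fun x => (inv_pos.2 (normConst_pos hs hS x)).le)
      hinv.integrableOn]
    have : Function.support (fun x => (normConst s S x)⁻¹) = Set.univ :=
      Set.eq_univ_of_forall fun x => (inv_pos.2 (normConst_pos hs hS x)).ne'
    rw [this, Set.univ_inter]
    exact hμ R
  · rw [mul_comm, ← integral_const_mul]
    calc ∫ x in A, Real.exp (-δ * sqNorm y) * (normConst s S x)⁻¹ ∂μ
        ≤ ∫ x in A, density s S x y ∂μ :=
          setIntegral_mono_on (hinv.const_mul _).integrableOn
            (integrable_density_left hs hS y).integrableOn hAm fun x hx => hR x y hx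
      _ ≤ outDensity s S μ y :=
          setIntegral_le_integral (integrable_density_left hs hS y)
            (Filter.Eventually.of_forall fun x => (density_pos hs hS x y).le)

lemma exists_abs_log_outDensity_le [IsProbabilityMeasure μ] (hs : 0 < s) (hS : S.PosDef)
    (hμ : ∀ R : ℝ, 0 < μ {x | R < sqNorm x}) {δ : ℝ} (hδ : 0 < δ) :
    ∃ C ≥ 0, ∀ y : Fin M → ℂ, |Real.log (outDensity s S μ y)| ≤ C + δ * sqNorm y := by
  obtain ⟨c, hc, hlow⟩ := exists_mul_exp_le_outDensity hs hS hμ hδ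
  obtain ⟨B, hB0, hB⟩ := exists_outDensity_le (μ := μ) hs hS
  refine ⟨|Real.log c| + |Real.log B|, by positivity, fun y => ?_⟩
  have h1 := Real.log_le_log (by positivity) (hlow y)
  rw [Real.log_mul hc.ne' (Real.exp_pos _).ne', Real.log_exp] at h1
  have h2 := Real.log_le_log (outDensity_pos hs hS y) (hB y)
  have := neg_abs_le (Real.log c)
  have := le_abs_self (Real.log B)
  have := abs_nonneg (Real.log c)
  have := abs_nonneg (Real.log B)
  have := mul_nonneg hδ.le (sqNorm_nonneg y)
  rw [abs_le]
  constructor <;> linarith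

lemma exists_density_le_mul_outDensity [IsProbabilityMeasure μ] (hs : 0 < s) (hS : S.PosDef)
    (hμ : ∀ R : ℝ, 0 < μ {x | R < sqNorm x}) (x : Fin N → ℂ) :
    ∃ C > 0, ∀ y : Fin M → ℂ, density s S x y ≤ C * outDensity s S μ y := by
  obtain ⟨δ, hδ, B, hB, h⟩ := exists_density_le_exp hs hS x
  obtain ⟨c, hc, hlow⟩ := exists_mul_exp_le_outDensity hs hS hμ hδ
  refine ⟨B / c, by positivity, fun y => (h y).trans ?_⟩
  rw [div_mul_eq_mul_div, le_div_iff₀ hc]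
  have := mul_le_mul_of_nonneg_left (hlow y) hB.le
  linarith

/-! ### The relative entropy of the output given an input -/

/-- The relative entropy `∫ p(y|x) log (p(y|x) / f(y)) dy` of the output law given the input `x`
with respect to the density `f`. -/
noncomputable def relEnt (s : ℝ) (S : Matrix (Fin M × Fin N) (Fin M × Fin N) ℂ)
    (f : (Fin M → ℂ) → ℝ) (x : Fin N → ℂ) : ℝ :=
  ∫ y, density s S x y * Real.log (density s S x y / f y)

lemma mutualInfo_eq : mutualInfo s S μ = ∫ x, relEnt s S (outDensity s S μ) x ∂μ := rfl

lemma integrable_density_mul_log_outDensity [IsProbabilityMeasure μ] (hs : 0 < s) (hS : S.PosDef)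
    (hμ : ∀ R : ℝ, 0 < μ {x | R < sqNorm x}) (x : Fin N → ℂ) :
    Integrable fun y => density s S x y * Real.log (outDensity s S μ y) := by
  obtain ⟨C, -, hC⟩ := exists_abs_log_outDensity_le hs hS hμ one_pos
  refine (((integrable_density hs hS x).const_mul C).add
    (integrable_density_mul_sqNorm hs hS x)).mono'
    ((continuous_density_right hs hS x).aestronglyMeasurable.mul
      (stronglyMeasurable_outDensity hs hS).measurable.log.aestronglyMeasurable)
    (Filter.Eventually.of_forall fun y => ?_)
  have hp := density_pos hs hS x y
  rw [norm_mul, Real.norm_of_nonneg hp.le]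
  refine (mul_le_mul_of_nonneg_left (hC y) hp.le).trans_eq ?_
  simp only [Pi.add_apply]
  ring

lemma integrable_density_mul_log_density (hs : 0 < s) (hS : S.PosDef) (x : Fin N → ℂ) :
    Integrable fun y => density s S x y * Real.log (density s S x y) := by
  have h : ∀ y, density s S x y * Real.log (density s S x y) =
      -(density s S x y * invForm (outCov s S x) y) -
        Real.log (normConst s S x) * density s S x y := by
    intro y
    have : Real.log (density s S x y) =
        -invForm (outCov s S x) y - Real.log (normConst s S x) := by
      rw [density_eq, Real.log_div (Real.exp_pos _).ne' (normConst_pos hs hS x).ne', Real.log_exp]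
    rw [this]; ring
  simp_rw [h]
  exact (integrable_density_mul_invForm hs hS x).neg.sub
    ((integrable_density hs hS x).const_mul _)

lemma density_mul_log_div [IsProbabilityMeasure μ] (hs : 0 < s) (hS : S.PosDef)
    (x : Fin N → ℂ) (y : Fin M → ℂ) :
    density s S x y * Real.log (density s S x y / outDensity s S μ y) =
      density s S x y * Real.log (density s S x y) -
        density s S x y * Real.log (outDensity s S μ y) := by
  rw [Real.log_div (density_pos hs hS x y).ne' (outDensity_pos hs hS y).ne']; ring

lemma integrable_relEnt_integrand [IsProbabilityMeasure μ] (hs : 0 < s) (hS : S.PosDef)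
    (hμ : ∀ R : ℝ, 0 < μ {x | R < sqNorm x}) (x : Fin N → ℂ) :
    Integrable fun y =>
      density s S x y * Real.log (density s S x y / outDensity s S μ y) := by
  simp_rw [density_mul_log_div hs hS]
  exact (integrable_density_mul_log_density hs hS x).sub
    (integrable_density_mul_log_outDensity hs hS hμ x)

/-- The variational lower bound for relative entropy, with the test function `L 1_A`. -/
lemma le_relEnt [IsProbabilityMeasure μ] (hs : 0 < s) (hS : S.PosDef)
    (hμ : ∀ R : ℝ, 0 < μ {x | R < sqNorm x}) {A : Set (Fin M → ℂ)} (hA : MeasurableSet A) (L : ℝ)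
    (x : Fin N → ℂ) :
    L * (∫ y in A, density s S x y) - (Real.exp L - 1) * ∫ y in A, outDensity s S μ y ≤
      relEnt s S (outDensity s S μ) x := by
  have hpi := integrable_density hs hS x
  have hfi := integrable_outDensity (M := M) (μ := μ) hs hS
  have hpA := hpi.indicator hA
  have hfA := hfi.indicator hA
  have h1 : Integrable fun y => L * A.indicator (density s S x) y + density s S x y :=
    (hpA.const_mul L).add hpi
  have h2 : Integrable fun y => outDensity s S μ y +
      (Real.exp L - 1) * A.indicator (outDensity s S μ) y := hfi.add (hfA.const_mul _)
  have hval : ∫ y, (L * A.indicator (density s S x) y + density s S x y -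
      (outDensity s S μ y + (Real.exp L - 1) * A.indicator (outDensity s S μ) y)) =
      L * (∫ y in A, density s S x y) - (Real.exp L - 1) * ∫ y in A, outDensity s S μ y := by
    rw [integral_sub h1 h2, integral_add (hpA.const_mul L) hpi,
      integral_add hfi (hfA.const_mul _), integral_const_mul, integral_const_mul,
      integral_indicator hA, integral_indicator hA, integral_density hs hS,
      integral_outDensity hs hS]
    ring
  rw [← hval]
  refine integral_mono (h1.sub h2) (integrable_relEnt_integrand hs hS hμ x) fun y => ?_
  have hp := density_pos hs hS x y
  have hf := outDensity_pos (μ := μ) hs hS y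
  -- `log t ≥ 1 - 1 / t`, applied to `t = p / (f e^φ)`
  have key : ∀ φ : ℝ, density s S x y * φ + density s S x y - outDensity s S μ y * Real.exp φ ≤
      density s S x y * Real.log (density s S x y / outDensity s S μ y) := by
    intro φ
    have h := Real.log_le_sub_one_of_pos
      (x := outDensity s S μ y * Real.exp φ / density s S x y) (by positivity)
    rw [Real.log_div (by positivity) hp.ne', Real.log_mul hf.ne' (Real.exp_pos _).ne',
      Real.log_exp] at h
    have h' := mul_le_mul_of_nonneg_left h hp.le
    have h'' : density s S x y * (outDensity s S μ y * Real.exp φ / density s S x y - 1) =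
        outDensity s S μ y * Real.exp φ - density s S x y := by field_simp
    rw [h''] at h'
    rw [Real.log_div hp.ne' hf.ne']
    linarith
  by_cases hy : y ∈ A
  · simp only [Set.indicator_of_mem hy]
    linarith [key L]
  · simp only [Set.indicator_of_notMem hy]
    have := key 0
    rw [Real.exp_zero] at this
    linarith

lemma relEnt_nonneg [IsProbabilityMeasure μ] (hs : 0 < s) (hS : S.PosDef)
    (hμ : ∀ R : ℝ, 0 < μ {x | R < sqNorm x}) (x : Fin N → ℂ) :
    0 ≤ relEnt s S (outDensity s S μ : (Fin M → ℂ) → ℝ) x := by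
  simpa using le_relEnt hs hS hμ MeasurableSet.empty 0 x

/-- Against the output density of an input with unbounded support, the relative entropy grows more
slowly than any multiple of the power. -/
lemma exists_relEnt_le [IsProbabilityMeasure μ] (hs : 0 < s) (hS : S.PosDef)
    (hμ : ∀ R : ℝ, 0 < μ {x | R < sqNorm x}) {ε : ℝ} (hε : 0 < ε) :
    ∃ C ≥ 0, ∀ x, relEnt s S (outDensity s S μ : (Fin M → ℂ) → ℝ) x ≤ C + ε * sqNorm x := by
  obtain ⟨T, hT, hT'⟩ := exists_integral_density_mul_sqNorm_le (N := N) hs hS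
  obtain ⟨B, hB0, hB⟩ := exists_density_le hs hS
  obtain ⟨C, hC0, hC⟩ := exists_abs_log_outDensity_le hs hS hμ (div_pos hε hT)
  refine ⟨|Real.log B| + C + ε, by positivity, fun x => ?_⟩
  have hpi := integrable_density hs hS x
  have hqi := integrable_density_mul_sqNorm hs hS x
  have hint : Integrable fun y => (|Real.log B| + C) * density s S x y +
      ε / T * (density s S x y * sqNorm y) := (hpi.const_mul _).add (hqi.const_mul _)
  calc relEnt s S (outDensity s S μ) x
      ≤ ∫ y, ((|Real.log B| + C) * density s S x y + ε / T * (density s S x y * sqNorm y)) := by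
        refine integral_mono (integrable_relEnt_integrand hs hS hμ x) hint fun y => ?_
        have hp := density_pos hs hS x y
        have h1 : Real.log (density s S x y / outDensity s S μ y) ≤
            |Real.log B| + (C + ε / T * sqNorm y) := by
          rw [Real.log_div hp.ne' (outDensity_pos hs hS y).ne']
          have h2 := Real.log_le_log hp (hB x y)
          have h3 := le_abs_self (Real.log B)
          have h4 := (abs_le.1 (hC y)).1
          linarith
        have := mul_le_mul_of_nonneg_left h1 hp.le
        simp only
        linarith
    _ = |Real.log B| + C + ε / T * ∫ y, density s S x y * sqNorm y := by
        rw [integral_add (hpi.const_mul _) (hqi.const_mul _), integral_const_mul,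
          integral_const_mul, integral_density hs hS, mul_one]
    _ ≤ |Real.log B| + C + ε / T * (T * (1 + sqNorm x)) := by
        gcongr
        exact hT' x
    _ = _ := by field_simp; ring

lemma integrable_relEnt [IsProbabilityMeasure μ] (hs : 0 < s) (hS : S.PosDef)
    (hμ : ∀ R : ℝ, 0 < μ {x | R < sqNorm x}) (hint : Integrable sqNorm μ) :
    Integrable (relEnt s S (outDensity s S μ : (Fin M → ℂ) → ℝ)) μ := by
  obtain ⟨C, -, hC⟩ := exists_relEnt_le (M := M) hs hS hμ one_pos
  have hd : Measurable fun p : (Fin N → ℂ) × (Fin M → ℂ) => density s S p.1 p.2 :=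
    (continuous_density hs hS).measurable
  have hm : StronglyMeasurable (Function.uncurry fun (x : Fin N → ℂ) (y : Fin M → ℂ) =>
      density s S x y * Real.log (density s S x y / outDensity s S μ y)) := by
    refine Measurable.stronglyMeasurable (hd.mul (Measurable.log (hd.div ?_)))
    exact (stronglyMeasurable_outDensity hs hS).measurable.comp measurable_snd
  refine ((integrable_const C).add hint).mono' hm.integral_prod_right.aestronglyMeasurable
    (Filter.Eventually.of_forall fun x => ?_)
  rw [Real.norm_of_nonneg (relEnt_nonneg hs hS hμ x)]
  simpa using hC x

lemma isBounded_sqNorm_le (r : ℝ) : Bornology.IsBounded {y : Fin M → ℂ | sqNorm y ≤ r} := by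
  refine (Metric.isBounded_closedBall (x := (0 : Fin M → ℂ)) (r := Real.sqrt r)).subset ?_
  intro y hy
  rw [mem_closedBall_zero_iff, pi_norm_le_iff_of_nonneg (Real.sqrt_nonneg r)]
  intro i
  refine Real.le_sqrt_of_sq_le (le_trans ?_ hy)
  exact Finset.single_le_sum (f := fun i => ‖y i‖ ^ 2) (fun _ _ => sq_nonneg _) (Finset.mem_univ i)

/-- The relative entropy is unbounded: inputs of large power push the output out of any ball,
whereas the density `f` keeps most of its mass in some ball. -/
lemma exists_lt_relEnt [IsProbabilityMeasure μ] (hM : 0 < M) (hN : 0 < N) (hs : 0 < s)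
    (hS : S.PosDef) (hμ : ∀ R : ℝ, 0 < μ {x | R < sqNorm x}) (I : ℝ) :
    ∃ x, I < relEnt s S (outDensity s S μ : (Fin M → ℂ) → ℝ) x := by
  -- if the output given `x` is outside the ball with probability at least `1 / 2`, and `f` has mass
  -- at most `exp (-L)` there, then `le_relEnt` gives at least `L / 2 - 1 = |I| + 1`
  set L : ℝ := 2 * (|I| + 2) with hL
  have hL0 : 0 < L := by positivity
  have hfi := integrable_outDensity (M := M) (μ := μ) hs hS
  let A : ℕ → Set (Fin M → ℂ) := fun n => {y | (n : ℝ) < sqNorm y}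
  have hAm : ∀ n, MeasurableSet (A n) := fun n =>
    (isOpen_lt continuous_const continuous_sqNorm).measurableSet
  have hlim := tendsto_setIntegral_of_antitone (μ := volume) hAm
    (fun m n hmn y (hy : (n : ℝ) < sqNorm y) =>
      lt_of_le_of_lt (Nat.cast_le.2 hmn : (m : ℝ) ≤ n) hy) ⟨0, hfi.integrableOn⟩
  have hempty : ⋂ n, A n = ∅ := by
    refine Set.eq_empty_of_forall_notMem fun y hy => ?_
    obtain ⟨n, hn⟩ := exists_nat_ge (sqNorm y)
    exact absurd (Set.mem_iInter.1 hy n) (not_lt.2 hn)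
  rw [hempty, Measure.restrict_empty, integral_zero_measure] at hlim
  obtain ⟨n, hn⟩ := (hlim.eventually_lt_const (Real.exp_pos (-L))).exists
  obtain ⟨x, hx⟩ := exists_lt_normConst hM hN hs hS (2 * volume.real (A n)ᶜ)
  refine ⟨x, lt_of_lt_of_le ?_ (le_relEnt hs hS hμ (hAm n) L x)⟩
  have hfin : volume (A n)ᶜ ≠ ⊤ := by
    have : (A n)ᶜ = {y | sqNorm y ≤ n} := by ext y; simp [A]
    rw [this]
    exact (isBounded_sqNorm_le _).measure_lt_top.ne
  have hpi := integrable_density hs hS x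
  have hnc := normConst_pos hs hS x
  have h1 : ∫ y in (A n)ᶜ, density s S x y ≤ 1 / 2 := by
    have h := setIntegral_mono_on hpi.integrableOn
      (integrableOn_const (C := (normConst s S x)⁻¹) hfin) (hAm n).compl
      fun y _ => density_le_inv_normConst hs hS x y
    refine h.trans ?_
    rw [setIntegral_const, smul_eq_mul, ← div_eq_mul_inv, div_le_iff₀ hnc]
    linarith
  have h2 := integral_add_compl (hAm n) hpi
  rw [integral_density hs hS] at h2
  have h3 : (Real.exp L - 1) * ∫ y in A n, outDensity s S μ y ≤ 1 := by
    have h0 : 0 ≤ ∫ y in A n, outDensity s S μ y :=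
      setIntegral_nonneg (hAm n) fun y _ => (outDensity_pos hs hS y).le
    have h4 := mul_le_mul_of_nonneg_left hn.le (Real.exp_pos L).le
    rw [← Real.exp_add, add_neg_cancel, Real.exp_zero] at h4
    linarith
  have h5 : L * (1 / 2) ≤ L * ∫ y in A n, density s S x y :=
    mul_le_mul_of_nonneg_left (by linarith) hL0.le
  have := le_abs_self I
  linarith

end Output

/-! ### Perturbation of the input measure -/

section Perturbation

variable {M N : ℕ} {s : ℝ} {S : Matrix (Fin M × Fin N) (Fin M × Fin N) ℂ}
  {μ : Measure (Fin N → ℂ)}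

/-- Mutual information is linear in the input up to a second-order term: if the output densities
of `ν` and `μ` are related by `f_ν = f_μ (1 + b)` with `|b| ≤ β`, then
`I(ν) ≥ ∫ D(p(·|x) ‖ f_μ) ν(dx) - β²`. The deficit is the relative entropy of `f_ν` with respect
to `f_μ`, which is at most `∫ f_μ b²`. -/
lemma integral_relEnt_sub_sq_le_mutualInfo [IsProbabilityMeasure μ] (hs : 0 < s) (hS : S.PosDef)
    (hμ : ∀ R : ℝ, 0 < μ {x | R < sqNorm x}) {ν : Measure (Fin N → ℂ)} [IsProbabilityMeasure ν]
    (hν : Integrable (relEnt s S (outDensity s S μ : (Fin M → ℂ) → ℝ)) ν)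
    {b : (Fin M → ℂ) → ℝ} (hbm : Measurable b) {β : ℝ} (hβ : β ≤ 1 / 2) (hb : ∀ y, |b y| ≤ β)
    (hf : ∀ y, outDensity s S ν y = outDensity s S μ y * (1 + b y)) :
    ∫ x, relEnt s S (outDensity s S μ) x ∂ν - β ^ 2 ≤ mutualInfo s S ν := by
  have hb1 : ∀ y, 1 / 2 ≤ 1 + b y := fun y => by have := (abs_le.1 (hb y)).1; linarith
  have hlog : ∀ y, |Real.log (1 + b y)| ≤ 1 := by
    intro y
    have h1 := hb1 y
    have h2 := Real.log_le_sub_one_of_pos (show 0 < 1 + b y by linarith)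
    have h3 := Real.one_sub_inv_le_log_of_pos (show 0 < 1 + b y by linarith)
    have h4 : (1 + b y)⁻¹ ≤ 2 := by
      rw [inv_le_comm₀ (by linarith) two_pos]; linarith
    have := (abs_le.1 (hb y)).2
    rw [abs_le]
    constructor <;> linarith
  have hlogm : Measurable fun y => Real.log (1 + b y) := (hbm.const_add 1).log
  obtain ⟨hi, hswap⟩ := integral_integral_density_mul (μ := ν) hs hS hlogm hlog
  have hrel : ∀ x, relEnt s S (outDensity s S ν) x = relEnt s S (outDensity s S μ) x -
      ∫ y, density s S x y * Real.log (1 + b y) := by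
    intro x
    rw [relEnt, relEnt, ← integral_sub (integrable_relEnt_integrand hs hS hμ x)
      ((integrable_density hs hS x).mul_bdd (c := 1) hlogm.aestronglyMeasurable
        (Filter.Eventually.of_forall hlog))]
    refine integral_congr_ae (Filter.Eventually.of_forall fun y => ?_)
    have hp := density_pos hs hS x y
    have hfy := outDensity_pos (μ := μ) hs hS y
    have h1 := hb1 y
    simp only
    rw [hf y, Real.log_div hp.ne' (by positivity), Real.log_div hp.ne' hfy.ne',
      Real.log_mul hfy.ne' (by linarith)]
    ring
  rw [mutualInfo_eq]
  simp_rw [hrel]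
  rw [integral_sub hν hi, hswap]
  have hfμ := integrable_outDensity (M := M) (μ := μ) hs hS
  have hfν := integrable_outDensity (M := M) (μ := ν) hs hS
  have hbd : ∫ y, outDensity s S ν y * Real.log (1 + b y) ≤
      ∫ y, (outDensity s S ν y - outDensity s S μ y + β ^ 2 * outDensity s S μ y) := by
    refine integral_mono (hfν.mul_bdd (c := 1) hlogm.aestronglyMeasurable
      (Filter.Eventually.of_forall hlog)) ((hfν.sub hfμ).add (hfμ.const_mul _)) fun y => ?_
    have hfy := outDensity_pos (μ := μ) hs hS y
    have h1 := hb1 y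
    have h2 := Real.log_le_sub_one_of_pos (show 0 < 1 + b y by linarith)
    have h3 : b y ^ 2 ≤ β ^ 2 := sq_le_sq' (by linarith [(abs_le.1 (hb y)).1]) (abs_le.1 (hb y)).2
    simp only
    calc outDensity s S ν y * Real.log (1 + b y)
        ≤ outDensity s S ν y * b y :=
          mul_le_mul_of_nonneg_left (by linarith) (outDensity_pos hs hS y).le
      _ = outDensity s S ν y - outDensity s S μ y + b y ^ 2 * outDensity s S μ y := by
          rw [hf y]; ring
      _ ≤ _ := by gcongr
  have hdiff : Integrable fun y => outDensity s S ν y - outDensity s S μ y := hfν.sub hfμ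
  rw [integral_add hdiff (hfμ.const_mul _), integral_sub hfν hfμ, integral_const_mul,
    integral_outDensity hs hS, integral_outDensity hs hS] at hbd
  linarith

/-- The input measure `μ + τ (μ(A) δ₀ - μ|_A + α (δ_z - μ))`: a fraction `τ` of the mass on `A` is
moved to the origin, and a fraction `τ α` of the whole mass is moved to the point `z`. The terms are
arranged so that all the weights are nonnegative when `τ (1 + α) ≤ 1`. -/
noncomputable def perturb (μ : Measure (Fin N → ℂ)) (A : Set (Fin N → ℂ)) (z : Fin N → ℂ)
    (α τ : ℝ) : Measure (Fin N → ℂ) :=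
  ENNReal.ofReal (1 - τ * (1 + α)) • μ + ENNReal.ofReal τ • μ.restrict Aᶜ +
    ENNReal.ofReal (τ * μ.real A) • Measure.dirac 0 + ENNReal.ofReal (τ * α) • Measure.dirac z

lemma integral_perturb {A : Set (Fin N → ℂ)} (hA : MeasurableSet A)
    (z : Fin N → ℂ) {α τ : ℝ} (hα : 0 ≤ α) (hτ : 0 ≤ τ) (hτα : τ * (1 + α) ≤ 1)
    {φ : (Fin N → ℂ) → ℝ} (hφ : Integrable φ μ) :
    Integrable φ (perturb μ A z α τ) ∧
    ∫ x, φ x ∂(perturb μ A z α τ) = ∫ x, φ x ∂μ +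
      τ * (μ.real A * φ 0 - ∫ x in A, φ x ∂μ + α * (φ z - ∫ x, φ x ∂μ)) := by
  have hd : ∀ w : Fin N → ℂ, Integrable φ (Measure.dirac w) := fun w =>
    integrable_dirac (by simp)
  have h1 : Integrable φ (ENNReal.ofReal (1 - τ * (1 + α)) • μ) :=
    hφ.smul_measure ENNReal.ofReal_ne_top
  have h2 : Integrable φ (ENNReal.ofReal τ • μ.restrict Aᶜ) :=
    hφ.restrict.smul_measure ENNReal.ofReal_ne_top
  have h3 : Integrable φ (ENNReal.ofReal (τ * μ.real A) • Measure.dirac 0) :=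
    (hd 0).smul_measure ENNReal.ofReal_ne_top
  have h4 : Integrable φ (ENNReal.ofReal (τ * α) • Measure.dirac z) :=
    (hd z).smul_measure ENNReal.ofReal_ne_top
  refine ⟨((h1.add_measure h2).add_measure h3).add_measure h4, ?_⟩
  rw [perturb, integral_add_measure ((h1.add_measure h2).add_measure h3) h4,
    integral_add_measure (h1.add_measure h2) h3, integral_add_measure h1 h2]
  simp only [integral_smul_measure, integral_dirac, smul_eq_mul]
  have hm : 0 ≤ μ.real A := measureReal_nonneg
  rw [ENNReal.toReal_ofReal (by linarith), ENNReal.toReal_ofReal hτ,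
    ENNReal.toReal_ofReal (by positivity), ENNReal.toReal_ofReal (by positivity)]
  have h := integral_add_compl hA hφ
  rw [← h]
  ring

lemma isProbabilityMeasure_perturb [IsProbabilityMeasure μ] {A : Set (Fin N → ℂ)}
    (hA : MeasurableSet A) (z : Fin N → ℂ) {α τ : ℝ} (hα : 0 ≤ α) (hτ : 0 ≤ τ)
    (hτα : τ * (1 + α) ≤ 1) : IsProbabilityMeasure (perturb μ A z α τ) := by
  have h := integral_perturb (μ := μ) hA z hα hτ hτα (φ := fun _ => 1) (integrable_const _)
  have hfin : IsFiniteMeasure (perturb μ A z α τ) := by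
    rw [← integrable_const_iff_isFiniteMeasure (c := (1 : ℝ)) one_ne_zero]
    exact h.1
  refine ⟨?_⟩
  have h2 := h.2
  simp only [integral_const, smul_eq_mul, mul_one, measureReal_restrict_apply_univ,
    probReal_univ, sub_self, mul_zero, add_zero] at h2
  rw [measureReal_def] at h2
  rw [← ENNReal.ofReal_toReal (measure_ne_top (perturb μ A z α τ) Set.univ), h2,
    ENNReal.ofReal_one]

/-- The relative change `τ b` of the output density under a perturbation is bounded, because
`p(·|0)` and `p(·|z)` are dominated by multiples of `f_μ`. -/
lemma exists_outDensity_perturb_eq [IsProbabilityMeasure μ] (hs : 0 < s) (hS : S.PosDef)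
    (hμ : ∀ R : ℝ, 0 < μ {x | R < sqNorm x}) {A : Set (Fin N → ℂ)}
    (hA : MeasurableSet A) (z : Fin N → ℂ) {α : ℝ} (hα : 0 ≤ α) :
    ∃ D > 0, ∃ b : (Fin M → ℂ) → ℝ, Measurable b ∧ (∀ y, |b y| ≤ D) ∧
      ∀ τ, 0 ≤ τ → τ * (1 + α) ≤ 1 → ∀ y,
        outDensity s S (perturb μ A z α τ) y = outDensity s S μ y * (1 + τ * b y) := by
  obtain ⟨C₀, hC₀, h₀⟩ := exists_density_le_mul_outDensity (M := M) hs hS hμ 0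
  obtain ⟨C₁, hC₁, h₁⟩ := exists_density_le_mul_outDensity (M := M) hs hS hμ z
  have hm : 0 ≤ μ.real A := measureReal_nonneg
  let r : (Fin M → ℂ) → ℝ := fun y => μ.real A * density s S 0 y -
    ∫ x in A, density s S x y ∂μ + α * (density s S z y - outDensity s S μ y)
  have hfm := (stronglyMeasurable_outDensity (M := M) (μ := μ) hs hS).measurable
  have hAmeas : Measurable fun y => ∫ x in A, density s S x y ∂μ :=
    (stronglyMeasurable_outDensity (μ := μ.restrict A) hs hS).measurable
  have hrm : Measurable r :=
    (((continuous_density_right hs hS 0).measurable.const_mul _).sub hAmeas).add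
      (((continuous_density_right hs hS z).measurable.sub hfm).const_mul _)
  refine ⟨μ.real A * C₀ + 1 + α * (C₁ + 1), by positivity, fun y => r y / outDensity s S μ y,
    hrm.div hfm, fun y => ?_, fun τ hτ hτα y => ?_⟩
  · have hf := outDensity_pos (μ := μ) hs hS y
    rw [abs_div, abs_of_pos hf, div_le_iff₀ hf]
    have h2 : ∫ x in A, density s S x y ∂μ ≤ outDensity s S μ y :=
      setIntegral_le_integral (integrable_density_left hs hS y)
        (Filter.Eventually.of_forall fun x => (density_pos hs hS x y).le)
    have h3 : 0 ≤ ∫ x in A, density s S x y ∂μ :=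
      setIntegral_nonneg hA fun x _ => (density_pos hs hS x y).le
    have h4 := mul_le_mul_of_nonneg_left (h₀ y) hm
    have h5 := mul_le_mul_of_nonneg_left (h₁ y) hα
    have h6 := mul_nonneg hm (density_pos hs hS 0 y).le
    have h7 := mul_nonneg hα (density_pos hs hS z y).le
    have h8 := mul_nonneg hα hf.le
    rw [abs_le]
    constructor <;> simp only [r] <;> linarith
  · have hf := outDensity_pos (μ := μ) hs hS y
    have h := (integral_perturb hA z hα hτ hτα (integrable_density_left (μ := μ) hs hS y)).2
    rw [outDensity, h]
    change outDensity s S μ y + τ * r y = outDensity s S μ y * (1 + τ * (r y / outDensity s S μ y))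
    field_simp

end Perturbation

/-! ### Optimal inputs have bounded support -/

section Optimal

variable {M N : ℕ} {s : ℝ} {S : Matrix (Fin M × Fin N) (Fin M × Fin N) ℂ}
  {μ : Measure (Fin N → ℂ)}

lemma power_eq (x : Fin N → ℂ) : power x = 1 / (N : ℝ) * sqNorm x := rfl

lemma integrable_sqNorm (hN : 0 < N) (h : Integrable power μ) : Integrable sqNorm μ := by
  refine (h.const_mul (N : ℝ)).congr (Filter.Eventually.of_forall fun x => ?_)
  have : (0 : ℝ) < N := Nat.cast_pos.2 hN
  simp only [power_eq]
  field_simp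

/-- First-order optimality: no admissible perturbation of a capacity-achieving input of unbounded
support increases the average relative entropy to first order. -/
lemma IsCapacityAchieving.variation_nonpos (hs : 0 < s) (hS : S.PosDef) (hN : 0 < N) {a : ℝ}
    (h : IsCapacityAchieving s S a μ) (hμ : ∀ R : ℝ, 0 < μ {x | R < sqNorm x})
    {A : Set (Fin N → ℂ)} (hA : MeasurableSet A) (z : Fin N → ℂ) {α : ℝ} (hα : 0 ≤ α)
    (hpow : μ.real A * sqNorm (0 : Fin N → ℂ) - ∫ x in A, sqNorm x ∂μ +
      α * (sqNorm z - ∫ x, sqNorm x ∂μ) ≤ 0) :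
    μ.real A * relEnt s S (outDensity s S μ) 0 - ∫ x in A, relEnt s S (outDensity s S μ) x ∂μ +
      α * (relEnt s S (outDensity s S μ) z - mutualInfo s S μ) ≤ 0 := by
  obtain ⟨⟨hprob, hint, ha⟩, hcap⟩ := h
  have hsq := integrable_sqNorm hN hint
  obtain ⟨D, hD, b, hbm, hbD, hb⟩ := exists_outDensity_perturb_eq (M := M) hs hS hμ hA z hα
  have hg := integrable_relEnt (M := M) hs hS hμ hsq
  set Λ := μ.real A * relEnt s S (outDensity s S μ) 0 -
    ∫ x in A, relEnt s S (outDensity s S μ) x ∂μ +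
      α * (relEnt s S (outDensity s S μ) z - mutualInfo s S μ) with hΛ
  -- the mutual information gains `τ Λ - τ² D²`, which is positive for small `τ` if `Λ > 0`
  have key : ∀ τ, 0 ≤ τ → τ * (1 + α) ≤ 1 → τ * D ≤ 1 / 2 → τ * Λ ≤ (τ * D) ^ 2 := by
    intro τ hτ hτα hτD
    have hprob' := isProbabilityMeasure_perturb (μ := μ) hA z hα hτ hτα
    have hsq' := integral_perturb hA z hα hτ hτα hsq
    have hg' := integral_perturb hA z hα hτ hτα hg
    have hfeas : perturb μ A z α τ ∈ feasible N a := by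
      refine ⟨hprob', hsq'.1.const_mul _, le_trans ?_ ha⟩
      simp only [power_eq]
      rw [integral_const_mul, integral_const_mul, hsq'.2]
      have := mul_nonpos_of_nonneg_of_nonpos hτ hpow
      gcongr
      linarith
    have hle : mutualInfo s S (perturb μ A z α τ) ≤ mutualInfo s S μ := by
      rw [← EReal.coe_le_coe_iff, hcap]
      exact le_iSup₂ (f := fun ν (_ : ν ∈ feasible N a) => ((mutualInfo s S ν : ℝ) : EReal)) _ hfeas
    have hlow := integral_relEnt_sub_sq_le_mutualInfo hs hS hμ hg'.1 (b := fun y => τ * b y)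
      (hbm.const_mul τ) hτD (fun y => by
        rw [abs_mul, abs_of_nonneg hτ]
        exact mul_le_mul_of_nonneg_left (hbD y) hτ) (hb τ hτ hτα)
    rw [hg'.2, ← mutualInfo_eq] at hlow
    linarith
  by_contra! hpos
  set τ := min (1 / (1 + α)) (min (1 / (2 * D)) (Λ / (2 * D ^ 2))) with hτdef
  have hτ : 0 < τ := by positivity
  have h1 : τ * (1 + α) ≤ 1 := by
    rw [← le_div_iff₀ (by positivity)]; exact min_le_left _ _
  have h2 : τ * D ≤ 1 / 2 := by
    rw [← le_div_iff₀ hD, div_div]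
    exact (min_le_right _ _).trans (min_le_left _ _)
  have h3 : τ * (2 * D ^ 2) ≤ Λ := by
    rw [← le_div_iff₀ (by positivity)]
    exact (min_le_right _ _).trans (min_le_right _ _)
  have h4 := key τ hτ.le h1 h2
  rw [mul_pow, sq τ, mul_assoc] at h4
  have h5 := le_of_mul_le_mul_left h4 hτ
  linarith

/-- A capacity-achieving input has bounded power: moving far mass to the origin saves power at a
relative cost that tends to zero, while spending it at a point of large relative entropy gains at a
fixed rate. -/
lemma IsCapacityAchieving.exists_measure_eq_zero (hM : 0 < M) (hN : 0 < N) (hs : 0 < s)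
    (hS : S.PosDef) {a : ℝ} (h : IsCapacityAchieving s S a μ) :
    ∃ R : ℝ, μ {x | R < sqNorm x} = 0 := by
  by_contra! hne
  have hμ : ∀ R : ℝ, 0 < μ {x | R < sqNorm x} := fun R => pos_iff_ne_zero.2 (hne R)
  have hprob : IsProbabilityMeasure μ := h.1.1
  have hsq := integrable_sqNorm hN h.1.2.1
  have hg := integrable_relEnt (M := M) hs hS hμ hsq
  obtain ⟨z, hz⟩ := exists_lt_relEnt hM hN hs hS hμ (mutualInfo s S μ)
  have hz0 := sqNorm_nonneg z
  -- the rate of gain per unit of power at `z`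
  set κ := (relEnt s S (outDensity s S μ) z - mutualInfo s S μ) / (sqNorm z + 1) with hκdef
  have hκ : 0 < κ := div_pos (by linarith) (by linarith)
  obtain ⟨C, hC0, hC⟩ := exists_relEnt_le (M := M) hs hS hμ (show 0 < κ / 3 by positivity)
  set R := 3 * C / κ + 1 with hR
  have hRC : C ≤ κ / 3 * R := by
    have : κ / 3 * R = C + κ / 3 := by rw [hR]; field_simp
    linarith
  have hR0 : 0 < R := by positivity
  set A : Set (Fin N → ℂ) := {x | R < sqNorm x} with hAdef
  have hA : MeasurableSet A := (isOpen_lt continuous_const continuous_sqNorm).measurableSet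
  have hmA : 0 < μ.real A := ENNReal.toReal_pos (hμ R).ne' (measure_ne_top _ _)
  set P := ∫ x in A, sqNorm x ∂μ with hP
  have hPpos : 0 < P := by
    have h1 := setIntegral_mono_on (μ := μ) (integrableOn_const (C := R) (measure_ne_top _ _))
      hsq.integrableOn hA fun x (hx : R < sqNorm x) => hx.le
    rw [setIntegral_const, smul_eq_mul] at h1
    exact lt_of_lt_of_le (by positivity) h1
  have hcost : ∫ x in A, relEnt s S (outDensity s S μ : (Fin M → ℂ) → ℝ) x ∂μ ≤
      2 * κ / 3 * P := by
    rw [hP, ← integral_const_mul]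
    refine setIntegral_mono_on hg.integrableOn (hsq.const_mul _).integrableOn hA
      fun x (hx : R < sqNorm x) => (hC x).trans ?_
    have : κ / 3 * R ≤ κ / 3 * sqNorm x := by gcongr
    linarith
  have hsq0 : sqNorm (0 : Fin N → ℂ) = 0 := by simp [sqNorm]
  have hz1 : 0 < sqNorm z + 1 := by linarith
  -- the power `P` saved on `A` is spent at `z`
  have hvar := h.variation_nonpos hs hS hN hμ hA z (α := P / (sqNorm z + 1)) (by positivity) (by
    have h1 : P / (sqNorm z + 1) * (sqNorm z + 1) = P := div_mul_cancel₀ _ hz1.ne'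
    have h2 : 0 ≤ P / (sqNorm z + 1) * ∫ x, sqNorm x ∂μ :=
      mul_nonneg (by positivity) (integral_nonneg sqNorm_nonneg)
    have h3 : 0 < P / (sqNorm z + 1) := by positivity
    rw [hsq0, ← hP]
    linarith)
  have hgain : P / (sqNorm z + 1) * (relEnt s S (outDensity s S μ) z - mutualInfo s S μ) =
      κ * P := by
    rw [hκdef]; ring
  rw [hgain] at hvar
  have h0 := mul_nonneg hmA.le (relEnt_nonneg (M := M) hs hS hμ 0)
  have := mul_pos hκ hPpos
  linarith

end Optimal

end RayleighChannel

theorem mainTheorem1 {M N : ℕ} (hM : 0 < M) (hN : 0 < N)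
    (s : ℝ) (hs : 0 < s)
    (S : Matrix (Fin M × Fin N) (Fin M × Fin N) ℂ) (hS : S.PosDef)
    (a : ℝ) (ha : 0 ≤ a)
    (μ : MeasureTheory.Measure (Fin N → ℂ))
    (hμ : RayleighChannel.IsCapacityAchieving s S a μ) :
    Bornology.IsBounded μ.support := by
  obtain ⟨R, hR⟩ := hμ.exists_measure_eq_zero hM hN hs hS
  refine (RayleighChannel.isBounded_sqNorm_le R).subset ?_
  refine Measure.support_subset_of_isClosed
    (isClosed_le RayleighChannel.continuous_sqNorm continuous_const) ?_
  rw [mem_ae_iff]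
  convert hR using 2
  ext x
  simp
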